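/- Let $n\ge 1$, let $X_n=\{1,\dots,n\}$, and let $\mathcal{DDP}_n$ be the semigroup, under composition, of all partial injective maps $\alpha$ of $X_n$ into itself such that $|x\alpha-y\alpha|=|x-y|$ for all $x,y\in\operatorname{Dom}\alpha$ and $x\alpha\le x$ for all $x\in\operatorname{Dom}\alpha$ (the order-decreasing partial isometries of $X_n$; the empty map is included). For a semigroup $S$, let $\mathcal L^*$ (respectively $\mathcal R^*$) be the relation on $S$ that holds between $a$ and $b$ when $a$ and $b$ are related by Green's relation $\mathcal L$ (respectively $\mathcal R$) in some semigroup containing $S$ as a subsemigroup, and let $\mathcal D^*$ be the smallest equivalence relation on $S$ containing $\mathcal L^*$ and $\mathcal R^*$. Then the number $d_n$ of $\mathcal D^*$-classes in $\mathcal{DDP}_n$ is $$d_n=\begin{cases}2^{n-1}-2^{\lfloor (n-3)/2\rfloor}+2^{\lfloor (n+1)/4\rfloor}, & \text{if } n\equiv -1,0 \pmod 4,\\[2pt] 2^{n-1}-2^{\lfloor (n-3)/2\rfloor}+3\cdot 2^{\lfloor (n-3)/4\rfloor}, & \text{if } n\equiv 1,2 \pmod 4,\end{cases}$$ where, for $n=1,2$,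 the exponents $\lfloor (n-3)/2\rfloor$ and $\lfloor (n-3)/4\rfloor$ are equal to $-1$, with $2^{-1}=\tfrac12$. -/

import Mathlib

universe u

section StarredGreen

variable {S : Type u} [Semigroup S]

/-- Green's relation `L` on a semigroup `S`: `S¹ a = S¹ b`. -/
def GreenL (a b : S) : Prop :=
  (∃ x : WithOne S, (a : WithOne S) = x * (b : WithOne S)) ∧
    ∃ y : WithOne S, (b : WithOne S) = y * (a : WithOne S)

/-- Green's relation `R` on a semigroup `S`: `a S¹ = b S¹`. -/
def GreenR (a b : S) : Prop :=
  (∃ x : WithOne S, (a : WithOne S) = (b : WithOne S) * x) ∧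
    ∃ y : WithOne S, (b : WithOne S) = (a : WithOne S) * y

/-- The starred relation `L*`: `a` and `b` are `L`-related in some oversemigroup of `S`. -/
def GreenLStar (a b : S) : Prop :=
  ∃ (T : Type u) (_ : Semigroup T) (φ : S →ₙ* T),
    Function.Injective φ ∧ GreenL (φ a) (φ b)

/-- The starred relation `R*`: `a` and `b` are `R`-related in some oversemigroup of `S`. -/
def GreenRStar (a b : S) : Prop :=
  ∃ (T : Type u) (_ : Semigroup T) (φ : S →ₙ* T),
    Function.Injective φ ∧ GreenR (φ a) (φ b)

/-- The starred relation `D*`: the join of `L*` and `R*`, that is, the smallest equivalence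
relation on `S` containing both. -/
def greenDStar (S : Type u) [Semigroup S] : Setoid S :=
  Relation.EqvGen.setoid fun a b => GreenLStar a b ∨ GreenRStar a b

end StarredGreen

/-- The symmetric inverse semigroup on an `n`-chain: all partial injective self-maps.
The chain `{1, …, n}` is modelled by `Fin n` (shifted by one). -/
abbrev SymInv (n : ℕ) : Type := Fin n ≃. Fin n

/-- Maps act on the right: `α * β` means first `α`, then `β`. -/
instance SymInv.instSemigroup (n : ℕ) : Semigroup (SymInv n) where
  mul α β := α.trans β
  mul_assoc := PEquiv.trans_assoc

theorem SymInv.mul_eq_trans {n : ℕ} (α β : SymInv n) : α * β = PEquiv.trans α β := rfl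

/-- `α` is a partial isometry: `|xα - yα| = |x - y|` for all `x, y` in its domain.
Here `x' ∈ α x` says that `x` lies in the domain of `α` and `xα = x'`. -/
def SymInv.IsPartialIsometry {n : ℕ} (α : SymInv n) : Prop :=
  ∀ x y x' y' : Fin n, x' ∈ α x → y' ∈ α y →
    |((x' : ℕ) : ℤ) - ((y' : ℕ) : ℤ)| = |((x : ℕ) : ℤ) - ((y : ℕ) : ℤ)|

/-- `α` is order-decreasing: `xα ≤ x` for all `x` in its domain. -/
def SymInv.IsOrderDecreasing {n : ℕ} (α : SymInv n) : Prop :=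
  ∀ x x' : Fin n, x' ∈ α x → x' ≤ x

/-- The semigroup of all order-decreasing partial isometries of an `n`-chain. -/
def DDP (n : ℕ) : Subsemigroup (SymInv n) where
  carrier := {α | α.IsPartialIsometry ∧ α.IsOrderDecreasing}
  mul_mem' := by
    rintro α β ⟨hα, hα'⟩ ⟨hβ, hβ'⟩
    refine ⟨?_, ?_⟩
    · intro x y x' y' hx hy
      rw [SymInv.mul_eq_trans, PEquiv.mem_trans] at hx hy
      obtain ⟨u, hu, hu'⟩ := hx
      obtain ⟨v, hv, hv'⟩ := hy
      rw [hβ u v x' y' hu' hv', hα x y u v hu hv]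
    · intro x x' hx
      rw [SymInv.mul_eq_trans, PEquiv.mem_trans] at hx
      obtain ⟨u, hu, hu'⟩ := hx
      exact (hβ' u x' hu').trans (hα' x u hu)

/-- The number of `D*`-classes of the semigroup `DDP n`. -/
noncomputable def numDStarClasses (n : ℕ) : ℕ :=
  Nat.card (Quotient (greenDStar (DDP n)))

/-! In `DDP n`, `L*` is equality of images and `R*` is equality of domains: partial identities
detect both sets through equations that persist in every oversemigroup, and the symmetric inverse
semigroup supplies the missing inverses (`greenLStar_iff`, `greenRStar_iff`). So `D*` is a relation
between subsets of the chain, generated by joining the domain of each map to its image.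

A partial isometry is a translation or a reflection. Translations bring every set to least element
0. A decreasing reflection `x ↦ c - x` of a set with minimum `m` and maximum `k` needs `k ≤ c ≤ 2 *
m`, so the length `k - m` is less than `n / 2`; conversely every such length allows one. Hence the
classes are the orbits of the involution `reflectShort n` on `normalSets n` (`greenDStar_iff`).

Twice the number of orbits is the number of normal sets plus the number of fixed ones. The fixed
ones are the empty set, the short palindromes and all long sets; sorting by maximum leaves geometric
sums. -/

open Finset in
/-- If the classes of `r` are the fibres, up to an involution `σ`, of a map onto `s`, they are
counted by averaging `s` and the fixed points of `σ` in `s`. -/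
theorem two_mul_card_quotient_of_involution {X α : Type*} [Countable α] [DecidableEq α]
    (r : Setoid X) (s : Finset α) (f : X → α) (hf : ∀ x, f x ∈ s) (hf' : ∀ a ∈ s, ∃ x, f x = a)
    (σ : α → α) (hσ : ∀ a ∈ s, σ a ∈ s) (hσ' : ∀ a ∈ s, σ (σ a) = a)
    (hr : ∀ x y, r x y ↔ f x = f y ∨ f x = σ (f y)) :
    2 * Nat.card (Quotient r) = #s + #{a ∈ s | σ a = a} := by
  classical
  -- The injection into `ℕ` only serves to order `α`: the smaller of `a` and `σ a` represents the
  -- orbit.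
  obtain ⟨e, he⟩ := exists_injective_nat α
  have key : Nat.card (Quotient r) = #{a ∈ s | e a ≤ e (σ a)} := by
    let g : α → α := fun a => if e a ≤ e (σ a) then a else σ a
    have hgg : ∀ a ∈ s, g (σ a) = g a := by
      intro a ha
      simp only [g, hσ' a ha]
      split_ifs with h1 h2 h2
      · exact he (le_antisymm h1 h2)
      · rfl
      · rfl
      · omega
    have hgmem : ∀ a ∈ s, g a ∈ ({a ∈ s | e a ≤ e (σ a)} : Finset α) := by
      intro a ha
      simp only [g, mem_filter]
      split_ifs with h
      · exact ⟨ha, h⟩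
      · rw [hσ' a ha]
        exact ⟨hσ a ha, by omega⟩
    have hgor : ∀ a, g a = a ∨ g a = σ a := by
      intro a
      simp only [g]
      split_ifs <;> simp
    have hwd : ∀ x y, r x y → g (f x) = g (f y) := by
      intro x y hxy
      rcases (hr x y).1 hxy with h | h
      · rw [h]
      · rw [h, hgg _ (hf y)]
    rw [← Nat.card_eq_finsetCard]
    refine Nat.card_congr (Equiv.ofBijective
      (Quotient.lift (fun x => ⟨g (f x), hgmem _ (hf x)⟩) fun x y h => Subtype.ext (hwd x y h))
      ⟨?_, ?_⟩)
    · intro p q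
      refine Quotient.inductionOn₂ p q fun x y h => Quotient.sound ((hr x y).2 ?_)
      have h : g (f x) = g (f y) := congrArg Subtype.val h
      have hx := hσ' _ (hf x)
      rcases hgor (f x) with h1 | h1 <;> rcases hgor (f y) with h2 | h2 <;> rw [h1, h2] at h
      · exact Or.inl h
      · exact Or.inr h
      · exact Or.inr (by rw [← h, hx])
      · exact Or.inl (by rw [← hx, h, hσ' _ (hf y)])
    · rintro ⟨a, ha⟩
      obtain ⟨ha, hle⟩ := mem_filter.1 ha
      obtain ⟨x, rfl⟩ := hf' a ha
      refine ⟨Quotient.mk _ x, Subtype.ext ?_⟩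
      exact if_pos hle
  -- `σ` exchanges the smaller and the larger representatives; these two sets cover `s` and meet in
  -- the fixed points.
  have hswap : #{a ∈ s | e a ≤ e (σ a)} = #{a ∈ s | e (σ a) ≤ e a} := by
    refine Finset.card_nbij' σ σ ?_ ?_ ?_ ?_
    · intro a ha
      simp only [coe_filter, Set.mem_ofPred_eq] at ha ⊢
      rw [hσ' a ha.1]
      exact ⟨hσ a ha.1, ha.2⟩
    · intro a ha
      simp only [coe_filter, Set.mem_ofPred_eq] at ha ⊢
      rw [hσ' a ha.1]
      exact ⟨hσ a ha.1, ha.2⟩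
    · intro a ha
      exact hσ' a (by simp at ha; exact ha.1)
    · intro a ha
      exact hσ' a (by simp at ha; exact ha.1)
  have hunion := Finset.card_union_add_card_inter {a ∈ s | e a ≤ e (σ a)} {a ∈ s | e (σ a) ≤ e a}
  have h1 : ({a ∈ s | e a ≤ e (σ a)} ∪ {a ∈ s | e (σ a) ≤ e a} : Finset α) = s := by
    ext a
    simp only [mem_union, mem_filter]
    have := le_total (e a) (e (σ a))
    tauto
  have h2 : ({a ∈ s | e a ≤ e (σ a)} ∩ {a ∈ s | e (σ a) ≤ e a} : Finset α)
      = {a ∈ s | σ a = a} := by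
    ext a
    simp only [mem_inter, mem_filter]
    constructor
    · rintro ⟨⟨h, h3⟩, -, h4⟩
      exact ⟨h, he (le_antisymm h4 h3)⟩
    · rintro ⟨h, h3⟩
      rw [h3]
      exact ⟨⟨h, le_rfl⟩, h, le_rfl⟩
  rw [h1, h2] at hunion
  omega

/-! ### Partial injections, their domains and images -/

theorem PEquiv.exists_of_rel {α β : Type*} (R : α → β → Prop)
    (h₁ : ∀ a b b', R a b → R a b' → b = b') (h₂ : ∀ a a' b, R a b → R a' b → a = a') :
    ∃ f : α ≃. β, ∀ a b, b ∈ f a ↔ R a b := by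
  classical
  have hto : ∀ a b, b ∈ (if h : ∃ b, R a b then some h.choose else none) ↔ R a b := by
    intro a b
    split_ifs with h
    · simp only [Option.mem_def, Option.some.injEq]
      exact ⟨fun h' => h' ▸ h.choose_spec, fun h' => h₁ _ _ _ h.choose_spec h'⟩
    · simp only [Option.mem_def, reduceCtorEq, false_iff]
      exact fun h' => h ⟨b, h'⟩
  have hinv : ∀ a b, a ∈ (if h : ∃ a, R a b then some h.choose else none) ↔ R a b := by
    intro a b
    split_ifs with h
    · simp only [Option.mem_def, Option.some.injEq]
      exact ⟨fun h' => h' ▸ h.choose_spec, fun h' => h₂ _ _ _ h.choose_spec h'⟩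
    · simp only [Option.mem_def, reduceCtorEq, false_iff]
      exact fun h' => h ⟨a, h'⟩
  exact ⟨⟨fun a => if h : ∃ b, R a b then some h.choose else none,
    fun b => if h : ∃ a, R a b then some h.choose else none,
    fun a b => (hinv a b).trans (hto a b).symm⟩, hto⟩

/-- The domain of a partial injection, as a set of natural numbers. -/
noncomputable def SymInv.domain {n : ℕ} (α : SymInv n) : Finset ℕ := by
  classical
  exact ({i : Fin n | ∃ j, j ∈ α i} : Finset (Fin n)).image (fun i => (i : ℕ))

/-- The image of a partial injection, as a set of natural numbers. -/
noncomputable def SymInv.range {n : ℕ} (α : SymInv n) : Finset ℕ := SymInv.domain α.symm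

namespace SymInv

variable {n : ℕ}

theorem mem_domain {α : SymInv n} {x : ℕ} :
    x ∈ domain α ↔ ∃ i j : Fin n, j ∈ α i ∧ (i : ℕ) = x := by
  simp [domain]

theorem mem_range {α : SymInv n} {y : ℕ} :
    y ∈ range α ↔ ∃ i j : Fin n, j ∈ α i ∧ (j : ℕ) = y := by
  unfold range
  rw [mem_domain, exists_comm]
  simp only [PEquiv.mem_iff_mem]

theorem domain_subset (α : SymInv n) : domain α ⊆ Finset.range n := by
  intro x hx
  obtain ⟨i, j, -, rfl⟩ := mem_domain.1 hx
  simp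

/-- The product of `β.symm` and `β` is the identity on the image of `β`. This makes `α` a left
multiple of `β`, as Green's relation `L` requires. -/
theorem mul_symm_mul_of_range_subset {α β : SymInv n} (h : range α ⊆ range β) :
    α * PEquiv.symm β * β = α := by
  refine PEquiv.ext fun i => Option.ext fun j => ?_
  rw [← Option.mem_def, ← Option.mem_def, mul_eq_trans, mul_eq_trans]
  simp only [PEquiv.mem_trans, PEquiv.mem_iff_mem]
  constructor
  · rintro ⟨k, ⟨l, hl, hl'⟩, hk⟩
    rwa [Option.mem_unique hk hl']
  · intro hj
    obtain ⟨k, l, hk, hl⟩ := mem_range.1 (h (mem_range.2 ⟨i, j, hj, rfl⟩))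
    obtain rfl := Fin.ext hl
    exact ⟨k, ⟨l, hj, hk⟩, hk⟩

theorem mul_symm_mul_of_domain_subset {α β : SymInv n} (h : domain α ⊆ domain β) :
    β * (PEquiv.symm β * α) = α := by
  refine PEquiv.ext fun i => Option.ext fun j => ?_
  rw [← Option.mem_def, ← Option.mem_def, mul_eq_trans, mul_eq_trans]
  simp only [PEquiv.mem_trans, PEquiv.mem_iff_mem]
  constructor
  · rintro ⟨k, hk, l, hl, hl'⟩
    rwa [β.inj hk hl]
  · intro hj
    obtain ⟨k, l, hk, hl⟩ := mem_domain.1 (h (mem_domain.2 ⟨i, j, hj, rfl⟩))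
    obtain rfl := Fin.ext hl
    exact ⟨l, hk, k, hk, hj⟩

end SymInv

/-! ### Partial identities as test elements -/

namespace DDP

open SymInv

variable {n : ℕ}

open Classical in
/-- The partial identity on `A`. -/
noncomputable def partialId (n : ℕ) (A : Finset ℕ) : DDP n :=
  ⟨PEquiv.ofSet {i : Fin n | (i : ℕ) ∈ A}, by
    constructor
    · intro x y x' y' hx hy
      rw [PEquiv.mem_ofSet_iff] at hx hy
      rw [hx.1, hy.1]
    · intro x x' hx
      rw [PEquiv.mem_ofSet_iff] at hx
      exact hx.1.le⟩

theorem mem_partialId {A : Finset ℕ} {i j : Fin n} :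
    j ∈ (partialId n A).1 i ↔ i = j ∧ (i : ℕ) ∈ A := by
  unfold partialId
  rw [PEquiv.mem_ofSet_iff, eq_comm]
  exact and_congr_right fun h => by subst h; rfl

theorem domain_partialId {A : Finset ℕ} (hA : A ⊆ Finset.range n) :
    domain (partialId n A).1 = A := by
  ext x
  simp only [mem_domain, mem_partialId]
  constructor
  · rintro ⟨i, j, ⟨rfl, h⟩, rfl⟩
    exact h
  · intro h
    have hx := Finset.mem_range.1 (hA h)
    exact ⟨⟨x, hx⟩, ⟨x, hx⟩, ⟨rfl, h⟩, rfl⟩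

theorem range_partialId {A : Finset ℕ} (hA : A ⊆ Finset.range n) :
    range (partialId n A).1 = A := by
  ext x
  simp only [mem_range, mem_partialId]
  constructor
  · rintro ⟨i, j, ⟨rfl, h⟩, rfl⟩
    exact h
  · intro h
    have hx := Finset.mem_range.1 (hA h)
    exact ⟨⟨x, hx⟩, ⟨x, hx⟩, ⟨rfl, h⟩, rfl⟩

theorem mul_partialId_eq_self {a : DDP n} {A : Finset ℕ} :
    a * partialId n A = a ↔ range a.1 ⊆ A := by
  rw [Subtype.ext_iff, MulMemClass.coe_mul, mul_eq_trans]
  constructor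
  · intro h y hy
    obtain ⟨i, j, hj, rfl⟩ := mem_range.1 hy
    rw [← h, PEquiv.mem_trans] at hj
    obtain ⟨k, -, hk⟩ := hj
    obtain ⟨rfl, h'⟩ := mem_partialId.1 hk
    exact h'
  · intro h
    refine PEquiv.ext fun i => Option.ext fun j => ?_
    rw [← Option.mem_def, ← Option.mem_def]
    simp only [PEquiv.mem_trans, mem_partialId]
    constructor
    · rintro ⟨k, hk, rfl, -⟩
      exact hk
    · intro hj
      exact ⟨j, hj, rfl, h (mem_range.2 ⟨i, j, hj, rfl⟩)⟩

theorem partialId_mul_eq_self {a : DDP n} {A : Finset ℕ} :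
    partialId n A * a = a ↔ domain a.1 ⊆ A := by
  rw [Subtype.ext_iff, MulMemClass.coe_mul, mul_eq_trans]
  constructor
  · intro h y hy
    obtain ⟨i, j, hj, rfl⟩ := mem_domain.1 hy
    rw [← h, PEquiv.mem_trans] at hj
    obtain ⟨k, hk, -⟩ := hj
    exact (mem_partialId.1 hk).2
  · intro h
    refine PEquiv.ext fun i => Option.ext fun j => ?_
    rw [← Option.mem_def, ← Option.mem_def]
    simp only [PEquiv.mem_trans, mem_partialId]
    constructor
    · rintro ⟨k, ⟨rfl, -⟩, hk⟩
      exact hk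
    · intro hj
      exact ⟨i, ⟨rfl, h (mem_domain.2 ⟨i, j, hj, rfl⟩)⟩, hj⟩

end DDP

/-! ### The starred relations in terms of domains and images -/

theorem GreenLStar.symm {S : Type*} [Semigroup S] {a b : S} (h : GreenLStar a b) :
    GreenLStar b a := by
  obtain ⟨T, hT, φ, hφ, h1, h2⟩ := h
  exact ⟨T, hT, φ, hφ, h2, h1⟩

theorem GreenRStar.symm {S : Type*} [Semigroup S] {a b : S} (h : GreenRStar a b) :
    GreenRStar b a := by
  obtain ⟨T, hT, φ, hφ, h1, h2⟩ := h
  exact ⟨T, hT, φ, hφ, h2, h1⟩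

/-- In the oversemigroup `a` is a left multiple of `b`, so whatever fixes `b` on the right fixes
`a`; injectivity of `φ` brings the equation back to `S`. -/
theorem GreenLStar.mul_eq_self {S : Type*} [Semigroup S] {a b e : S} (h : GreenLStar a b)
    (he : b * e = b) : a * e = a := by
  obtain ⟨T, _, φ, hφ, ⟨x, hx⟩, -⟩ := h
  apply hφ
  rw [← WithOne.coe_inj, map_mul, WithOne.coe_mul, hx, mul_assoc, ← WithOne.coe_mul, ← map_mul, he]

theorem GreenRStar.mul_eq_self {S : Type*} [Semigroup S] {a b e : S} (h : GreenRStar a b)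
    (he : e * b = b) : e * a = a := by
  obtain ⟨T, _, φ, hφ, ⟨x, hx⟩, -⟩ := h
  apply hφ
  rw [← WithOne.coe_inj, map_mul, WithOne.coe_mul, hx, ← mul_assoc, ← WithOne.coe_mul, ← map_mul,
    he]

namespace DDP

open SymInv

variable {n : ℕ}

theorem greenLStar_iff {a b : DDP n} : GreenLStar a b ↔ range a.1 = range b.1 := by
  constructor
  · intro h
    have aux : ∀ {a b : DDP n}, GreenLStar a b → range a.1 ⊆ range b.1 := fun h =>
      mul_partialId_eq_self.1 (h.mul_eq_self (mul_partialId_eq_self.2 subset_rfl))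
    exact (aux h).antisymm (aux h.symm)
  · intro h
    refine ⟨SymInv n, inferInstance, MulMemClass.subtype (DDP n), Subtype.val_injective,
      ⟨((a.1 * PEquiv.symm b.1 : SymInv n) : WithOne (SymInv n)), ?_⟩,
      ⟨((b.1 * PEquiv.symm a.1 : SymInv n) : WithOne (SymInv n)), ?_⟩⟩
    · rw [← WithOne.coe_mul]
      exact congrArg _ (mul_symm_mul_of_range_subset h.subset).symm
    · rw [← WithOne.coe_mul]
      exact congrArg _ (mul_symm_mul_of_range_subset h.symm.subset).symm

theorem greenRStar_iff {a b : DDP n} : GreenRStar a b ↔ domain a.1 = domain b.1 := by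
  constructor
  · intro h
    have aux : ∀ {a b : DDP n}, GreenRStar a b → domain a.1 ⊆ domain b.1 := fun h =>
      partialId_mul_eq_self.1 (h.mul_eq_self (partialId_mul_eq_self.2 subset_rfl))
    exact (aux h).antisymm (aux h.symm)
  · intro h
    refine ⟨SymInv n, inferInstance, MulMemClass.subtype (DDP n), Subtype.val_injective,
      ⟨((PEquiv.symm b.1 * a.1 : SymInv n) : WithOne (SymInv n)), ?_⟩,
      ⟨((PEquiv.symm a.1 * b.1 : SymInv n) : WithOne (SymInv n)), ?_⟩⟩
    · rw [← WithOne.coe_mul]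
      exact congrArg _ (mul_symm_mul_of_domain_subset h.subset).symm
    · rw [← WithOne.coe_mul]
      exact congrArg _ (mul_symm_mul_of_domain_subset h.symm.subset).symm

theorem greenDStar_of_domain_eq {a b : DDP n} (h : domain a.1 = domain b.1) :
    greenDStar (DDP n) a b :=
  Relation.EqvGen.rel _ _ (Or.inr (greenRStar_iff.2 h))

theorem greenDStar_of_range_eq {a b : DDP n} (h : range a.1 = range b.1) :
    greenDStar (DDP n) a b :=
  Relation.EqvGen.rel _ _ (Or.inl (greenLStar_iff.2 h))

theorem greenDStar_partialId_domain (a : DDP n) :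
    greenDStar (DDP n) a (partialId n (domain a.1)) :=
  greenDStar_of_domain_eq (domain_partialId (domain_subset _)).symm

/-- The restriction of `f` to `A` lies in `DDP n`; it is `R*`-related to the first partial identity
and `L*`-related to the second. -/
theorem greenDStar_partialId_image {A : Finset ℕ} (hA : A ⊆ Finset.range n) (f : ℕ → ℕ)
    (hle : ∀ x ∈ A, f x ≤ x)
    (hf : ∀ x ∈ A, ∀ y ∈ A, |(f x : ℤ) - f y| = |(x : ℤ) - y|) :
    greenDStar (DDP n) (partialId n A) (partialId n (A.image f)) := by
  obtain ⟨α, hα⟩ := PEquiv.exists_of_rel (fun i j : Fin n => (i : ℕ) ∈ A ∧ f i = j)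
    (by
      rintro a b b' ⟨-, h⟩ ⟨-, h'⟩
      exact Fin.ext (h.symm.trans h'))
    (by
      rintro a a' b ⟨h, h1⟩ ⟨h', h1'⟩
      have := hf _ h _ h'
      rw [h1, h1', sub_self, abs_zero, eq_comm, abs_eq_zero] at this
      exact Fin.ext (by omega))
  have hmem : (α : SymInv n) ∈ DDP n := by
    constructor
    · intro x y x' y' hx hy
      obtain ⟨hx, hx'⟩ := (hα _ _).1 hx
      obtain ⟨hy, hy'⟩ := (hα _ _).1 hy
      rw [← hx', ← hy']
      exact hf _ hx _ hy
    · intro x x' hx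
      obtain ⟨hx, hx'⟩ := (hα _ _).1 hx
      exact Fin.le_def.2 (hx' ▸ hle _ hx)
  have hB : A.image f ⊆ Finset.range n := by
    intro y hy
    obtain ⟨x, hx, rfl⟩ := Finset.mem_image.1 hy
    exact Finset.mem_range.2 ((hle x hx).trans_lt (Finset.mem_range.1 (hA hx)))
  have hdom : domain α = A := by
    ext x
    simp only [mem_domain, hα]
    constructor
    · rintro ⟨i, j, ⟨h, -⟩, rfl⟩
      exact h
    · intro h
      have hx := Finset.mem_range.1 (hA h)
      exact ⟨⟨x, hx⟩, ⟨f x, (hle x h).trans_lt hx⟩, ⟨h, rfl⟩, rfl⟩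
  have hran : range α = A.image f := by
    ext y
    simp only [mem_range, hα, Finset.mem_image]
    constructor
    · rintro ⟨i, j, ⟨h, h'⟩, rfl⟩
      exact ⟨i, h, h'⟩
    · rintro ⟨x, h, rfl⟩
      have hx := Finset.mem_range.1 (hA h)
      exact ⟨⟨x, hx⟩, ⟨f x, (hle x h).trans_lt hx⟩, ⟨h, rfl⟩, rfl⟩
  refine Setoid.trans' _ (y := (⟨α, hmem⟩ : DDP n)) ?_ ?_
  · exact greenDStar_of_domain_eq ((domain_partialId hA).trans hdom.symm)
  · exact greenDStar_of_range_eq (hran.trans (range_partialId hB).symm)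

end DDP

/-! ### Normal forms of sets under translation and reflection -/

/-- The translate of a set of natural numbers with least element `0`. -/
noncomputable def shiftDown (A : Finset ℕ) : Finset ℕ := A.image (· - sInf (A : Set ℕ))

/-- The reflection of `s ⊆ {0, …, n - 1}` in the midpoint of its convex hull when `0 ∈ s` and its
length is less than `n / 2`; longer sets are left alone. -/
def reflectShort (n : ℕ) (s : Finset ℕ) : Finset ℕ :=
  if 2 * s.sup id < n then s.image (s.sup id - ·) else s

/-- The subsets of `{0, …, n - 1}` which are empty or have least element `0`. -/
def normalSets (n : ℕ) : Finset (Finset ℕ) :=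
  {s ∈ (Finset.range n).powerset | s = ∅ ∨ 0 ∈ s}

theorem mem_normalSets {n : ℕ} {s : Finset ℕ} :
    s ∈ normalSets n ↔ s ⊆ Finset.range n ∧ (s = ∅ ∨ 0 ∈ s) := by
  simp [normalSets]

theorem Finset.exists_isLeast_nat {A : Finset ℕ} (hA : A.Nonempty) :
    ∃ m ∈ A, ∀ x ∈ A, m ≤ x :=
  ⟨A.min' hA, A.min'_mem hA, fun x hx => A.min'_le x hx⟩

theorem Finset.exists_isGreatest_nat {A : Finset ℕ} (hA : A.Nonempty) :
    ∃ m ∈ A, ∀ x ∈ A, x ≤ m :=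
  ⟨A.max' hA, A.max'_mem hA, fun x hx => A.le_max' x hx⟩

theorem Finset.sup_id_eq {A : Finset ℕ} {k : ℕ} (hk : k ∈ A) (h : ∀ x ∈ A, x ≤ k) :
    A.sup id = k :=
  le_antisymm (Finset.sup_le h) (Finset.le_sup (f := id) hk)

@[simp]
theorem shiftDown_empty : shiftDown ∅ = ∅ := rfl

@[simp]
theorem reflectShort_empty (n : ℕ) : reflectShort n ∅ = ∅ := by simp [reflectShort]

theorem shiftDown_eq {A : Finset ℕ} {m : ℕ} (hm : m ∈ A) (h : ∀ x ∈ A, m ≤ x) :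
    shiftDown A = A.image (· - m) := by
  have : sInf (A : Set ℕ) = m := IsLeast.csInf_eq ⟨hm, fun x hx => h x hx⟩
  rw [shiftDown, this]

theorem reflectShort_eq {n k : ℕ} {s : Finset ℕ} (hk : k ∈ s) (h : ∀ x ∈ s, x ≤ k) (hkn : 2 * k < n) :
    reflectShort n s = s.image (k - ·) := by
  rw [reflectShort, Finset.sup_id_eq hk h, if_pos hkn]

theorem reflectShort_eq_self {n k : ℕ} {s : Finset ℕ} (hk : k ∈ s) (hkn : n ≤ 2 * k) :
    reflectShort n s = s := by
  have := Finset.le_sup (f := id) hk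
  exact if_neg (by simp only [id] at this; omega)

theorem shiftDown_mem_normalSets {n : ℕ} {A : Finset ℕ} (hA : A ⊆ Finset.range n) :
    shiftDown A ∈ normalSets n := by
  rcases A.eq_empty_or_nonempty with rfl | hne
  · simp [mem_normalSets]
  obtain ⟨m, hm, h⟩ := Finset.exists_isLeast_nat hne
  rw [shiftDown_eq hm h, mem_normalSets]
  refine ⟨?_, Or.inr (Finset.mem_image.2 ⟨m, hm, Nat.sub_self m⟩)⟩
  intro x hx
  obtain ⟨y, hy, rfl⟩ := Finset.mem_image.1 hx
  have := Finset.mem_range.1 (hA hy)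
  exact Finset.mem_range.2 (by omega)

theorem shiftDown_of_mem_normalSets {n : ℕ} {s : Finset ℕ} (hs : s ∈ normalSets n) :
    shiftDown s = s := by
  rcases (mem_normalSets.1 hs).2 with rfl | h0
  · simp
  · rw [shiftDown_eq h0 fun x _ => Nat.zero_le x]
    simp

theorem shiftDown_image_add (s : Finset ℕ) (c : ℕ) :
    shiftDown (s.image (· + c)) = shiftDown s := by
  rcases s.eq_empty_or_nonempty with rfl | hne
  · simp
  obtain ⟨m, hm, h⟩ := Finset.exists_isLeast_nat hne
  rw [shiftDown_eq hm h, shiftDown_eq (Finset.mem_image_of_mem _ hm), Finset.image_image]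
  · refine Finset.image_congr fun x _ => ?_
    simp only [Function.comp]
    omega
  · intro x hx
    obtain ⟨y, hy, rfl⟩ := Finset.mem_image.1 hx
    exact Nat.add_le_add_right (h y hy) c

/-- The bound `c ≤ 2 * x` says that `x ↦ c - x` is decreasing at `x`. With minimum `m` and maximum
`k` it gives `2 * (k - m) ≤ k < n`, so `reflectShort` does reflect. -/
theorem shiftDown_image_sub {n c : ℕ} {A : Finset ℕ} (hA : A ⊆ Finset.range n)
    (hc : ∀ x ∈ A, x ≤ c ∧ c ≤ 2 * x) :
    shiftDown (A.image (c - ·)) = reflectShort n (shiftDown A) := by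
  rcases A.eq_empty_or_nonempty with rfl | hne
  · simp
  obtain ⟨m, hm, h⟩ := Finset.exists_isLeast_nat hne
  obtain ⟨k, hk, h'⟩ := Finset.exists_isGreatest_nat hne
  have hkn := Finset.mem_range.1 (hA hk)
  have h1 := hc k hk
  have h2 := hc m hm
  have h3 := h k hk
  rw [shiftDown_eq hm h, shiftDown_eq (Finset.mem_image_of_mem _ hk),
    reflectShort_eq (s := A.image (· - m)) (k := k - m) (Finset.mem_image_of_mem _ hk), Finset.image_image, Finset.image_image]
  · refine Finset.image_congr fun x hx => ?_
    have h4 := h x hx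
    have h5 := h' x hx
    simp only [Function.comp]
    omega
  · intro x hx
    obtain ⟨y, hy, rfl⟩ := Finset.mem_image.1 hx
    exact Nat.sub_le_sub_right (h' y hy) m
  · omega
  · intro x hx
    obtain ⟨y, hy, rfl⟩ := Finset.mem_image.1 hx
    exact Nat.sub_le_sub_left (h' y hy) c

theorem reflectShort_mem_normalSets {n : ℕ} {s : Finset ℕ} (hs : s ∈ normalSets n) :
    reflectShort n s ∈ normalSets n := by
  rcases s.eq_empty_or_nonempty with rfl | hne
  · simpa using hs
  obtain ⟨k, hk, h⟩ := Finset.exists_isGreatest_nat hne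
  rcases lt_or_ge (2 * k) n with hkn | hkn
  · rw [reflectShort_eq hk h hkn, mem_normalSets]
    refine ⟨?_, Or.inr (Finset.mem_image.2 ⟨k, hk, Nat.sub_self k⟩)⟩
    intro x hx
    obtain ⟨y, hy, rfl⟩ := Finset.mem_image.1 hx
    exact Finset.mem_range.2 (by omega)
  · rwa [reflectShort_eq_self hk hkn]

theorem reflectShort_reflectShort {n : ℕ} {s : Finset ℕ} (hs : s ∈ normalSets n) : reflectShort n (reflectShort n s) = s := by
  rcases (mem_normalSets.1 hs).2 with rfl | h0
  · simp
  obtain ⟨k, hk, h⟩ := Finset.exists_isGreatest_nat ⟨0, h0⟩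
  rcases lt_or_ge (2 * k) n with hkn | hkn
  -- The reflected set has the same maximum `k`, the mirror image of `0`.
  · rw [reflectShort_eq hk h hkn, reflectShort_eq (k := k) (Finset.mem_image.2 ⟨0, h0, Nat.sub_zero k⟩) _ hkn,
      Finset.image_image]
    · conv_rhs => rw [← Finset.image_id (s := s)]
      refine Finset.image_congr fun x hx => ?_
      have := h x hx
      simp only [Function.comp, id]
      omega
    · intro x hx
      obtain ⟨y, hy, rfl⟩ := Finset.mem_image.1 hx
      exact Nat.sub_le k y
  · rw [reflectShort_eq_self hk hkn, reflectShort_eq_self hk hkn]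

/-! ### Classification of the `D*`-classes -/

namespace DDP

open SymInv

variable {n : ℕ}

theorem translation_or_reflection (a : DDP n) :
    (∃ c : ℕ, ∀ i j : Fin n, j ∈ a.1 i → (i : ℕ) = j + c) ∨
      ∃ c : ℕ, ∀ i j : Fin n, j ∈ a.1 i → (i : ℕ) + j = c := by
  rcases (domain a.1).eq_empty_or_nonempty with he | hne
  · refine Or.inl ⟨0, fun i j hj => ?_⟩
    have := mem_domain.2 ⟨i, j, hj, rfl⟩
    simp [he] at this
  obtain ⟨m, hm, hmin⟩ := Finset.exists_isLeast_nat hne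
  obtain ⟨i₀, j₀, h₀, rfl⟩ := mem_domain.1 hm
  have hle : (j₀ : ℕ) ≤ i₀ := a.2.2 i₀ j₀ h₀
  have hmin' : ∀ i j : Fin n, j ∈ a.1 i → (i₀ : ℕ) ≤ i := fun i j hj =>
    hmin _ (mem_domain.2 ⟨i, j, hj, rfl⟩)
  by_cases H : ∀ i j : Fin n, j ∈ a.1 i → (i : ℕ) + j₀ = j + i₀
  · refine Or.inl ⟨i₀ - j₀, fun i j hj => ?_⟩
    have := H i j hj
    omega
  · push Not at H
    obtain ⟨i₁, j₁, h₁, hne₁⟩ := H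
    refine Or.inr ⟨i₀ + j₀, fun i j hj => ?_⟩
    -- The point `i₁` is reflected about `i₀`. Comparing `i` with both `i₀` and `i₁` forces `i` to
    -- be reflected too.
    have e1 := hmin' _ _ h₁
    have e2 := hmin' _ _ hj
    rcases abs_eq_abs.1 (a.2.1 _ _ _ _ h₁ h₀) with e3 | e3 <;>
    rcases abs_eq_abs.1 (a.2.1 _ _ _ _ hj h₀) with e4 | e4 <;>
    rcases abs_eq_abs.1 (a.2.1 _ _ _ _ hj h₁) with e5 | e5 <;> omega

theorem shiftDown_range_eq (a : DDP n) :
    shiftDown (range a.1) = shiftDown (domain a.1) ∨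
      shiftDown (range a.1) = reflectShort n (shiftDown (domain a.1)) := by
  rcases translation_or_reflection a with ⟨c, hc⟩ | ⟨c, hc⟩
  · left
    rw [← shiftDown_image_add (range a.1) c]
    congr 1
    ext x
    simp only [Finset.mem_image, mem_range, mem_domain]
    constructor
    · rintro ⟨_, ⟨i, j, hj, rfl⟩, rfl⟩
      exact ⟨i, j, hj, hc i j hj⟩
    · rintro ⟨i, j, hj, rfl⟩
      exact ⟨j, ⟨i, j, hj, rfl⟩, (hc i j hj).symm⟩
  · right
    rw [← shiftDown_image_sub (domain_subset a.1) (c := c)]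
    · congr 1
      ext x
      simp only [Finset.mem_image, mem_range, mem_domain]
      constructor
      · rintro ⟨i, j, hj, rfl⟩
        refine ⟨i, ⟨i, j, hj, rfl⟩, ?_⟩
        have := hc i j hj
        omega
      · rintro ⟨_, ⟨i, j, hj, rfl⟩, rfl⟩
        refine ⟨i, j, hj, ?_⟩
        have := hc i j hj
        omega
    · intro x hx
      obtain ⟨i, j, hj, rfl⟩ := mem_domain.1 hx
      have h1 := hc i j hj
      have h2 : (j : ℕ) ≤ i := a.2.2 i j hj
      omega

theorem greenDStar_partialId_shiftDown {A : Finset ℕ} (hA : A ⊆ Finset.range n) :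
    greenDStar (DDP n) (partialId n A) (partialId n (shiftDown A)) := by
  refine greenDStar_partialId_image hA _ (fun x _ => Nat.sub_le _ _) fun x hx y hy => ?_
  have h1 := Nat.sInf_le (s := (A : Set ℕ)) hx
  have h2 := Nat.sInf_le (s := (A : Set ℕ)) hy
  rw [Nat.cast_sub h1, Nat.cast_sub h2]
  congr 1
  ring

/-- With `k` the maximum of a short `s`, the translate `s + k` lies in `{k, …, 2k}`, which fits in
the chain since `2 * k < n`. There `x ↦ 2 * k - x` is decreasing. -/
theorem greenDStar_partialId_reflectShort {s : Finset ℕ} (hs : s ∈ normalSets n) :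
    greenDStar (DDP n) (partialId n s) (partialId n (reflectShort n s)) := by
  rcases s.eq_empty_or_nonempty with rfl | hne
  · rw [reflectShort_empty]
  obtain ⟨k, hk, h⟩ := Finset.exists_isGreatest_nat hne
  rcases lt_or_ge (2 * k) n with hkn | hkn
  · have hA : s.image (· + k) ⊆ Finset.range n := by
      intro x hx
      obtain ⟨y, hy, rfl⟩ := Finset.mem_image.1 hx
      have := h y hy
      exact Finset.mem_range.2 (by omega)
    have h1 := greenDStar_partialId_shiftDown hA
    rw [shiftDown_image_add, shiftDown_of_mem_normalSets hs] at h1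
    have h2 := greenDStar_partialId_image hA (2 * k - ·)
      (by
        intro x hx
        obtain ⟨y, hy, rfl⟩ := Finset.mem_image.1 hx
        omega)
      (by
        intro x hx y hy
        obtain ⟨u, hu, rfl⟩ := Finset.mem_image.1 hx
        obtain ⟨v, hv, rfl⟩ := Finset.mem_image.1 hy
        have := h u hu
        have := h v hv
        rw [abs_eq_abs]
        omega)
    have h3 : (s.image (· + k)).image (2 * k - ·) = reflectShort n s := by
      rw [reflectShort_eq hk h hkn, Finset.image_image]
      refine Finset.image_congr fun x hx => ?_
      have := h x hx
      simp only [Function.comp]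
      omega
    rw [h3] at h2
    exact Setoid.trans' _ (Setoid.symm' _ h1) h2
  · rw [reflectShort_eq_self hk hkn]

theorem shiftDown_domain_mem (a : DDP n) : shiftDown (domain a.1) ∈ normalSets n :=
  shiftDown_mem_normalSets (domain_subset _)

/-- The right-hand side is an equivalence because `reflectShort n` is an involution on normal sets,
and it contains `L*` and `R*`. Conversely, both elements are joined to partial identities on normal
sets. -/
theorem greenDStar_iff (a b : DDP n) :
    greenDStar (DDP n) a b ↔ shiftDown (domain a.1) = shiftDown (domain b.1) ∨
      shiftDown (domain a.1) = reflectShort n (shiftDown (domain b.1)) := by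
  have hff : ∀ a : DDP n,
      reflectShort n (reflectShort n (shiftDown (domain a.1))) = shiftDown (domain a.1) :=
    fun a => reflectShort_reflectShort (shiftDown_domain_mem a)
  constructor
  · intro h
    change Relation.EqvGen _ a b at h
    induction h with
    | rel a b h =>
      rcases h with h | h
      · have h1 := shiftDown_range_eq a
        rw [greenLStar_iff.1 h] at h1
        have ha := hff a
        have hb := hff b
        rcases h1 with h1 | h1 <;> rcases shiftDown_range_eq b with h2 | h2 <;> rw [h2] at h1
        · exact Or.inl h1.symm
        · exact Or.inr h1.symm
        · exact Or.inr (by rw [h1, ha])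
        · exact Or.inl (by rw [← ha, ← h1, hb])
      · exact Or.inl (by rw [greenRStar_iff.1 h])
    | refl a => exact Or.inl rfl
    | symm a b _ ih =>
      rcases ih with ih | ih
      · exact Or.inl ih.symm
      · exact Or.inr (by rw [ih, hff])
    | trans a b c _ _ ih₁ ih₂ =>
      rcases ih₁ with h1 | h1 <;> rcases ih₂ with h2 | h2 <;> rw [h2] at h1
      · exact Or.inl h1
      · exact Or.inr h1
      · exact Or.inr h1
      · exact Or.inl (by rw [h1, hff])
  · intro h
    have key : ∀ a : DDP n,
        greenDStar (DDP n) a (partialId n (shiftDown (domain a.1))) := fun a =>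
      Setoid.trans' _ (greenDStar_partialId_domain a)
        (greenDStar_partialId_shiftDown (domain_subset _))
    refine Setoid.trans' _ (key a) (Setoid.symm' _ ?_)
    rcases h with h | h <;> rw [h]
    · exact key b
    · exact Setoid.trans' _ (key b) (greenDStar_partialId_reflectShort (shiftDown_domain_mem b))

end DDP

theorem two_mul_numDStarClasses (n : ℕ) :
    2 * numDStarClasses n =
      (normalSets n).card + ((normalSets n).filter fun s => reflectShort n s = s).card := by
  have hsurj : ∀ s ∈ normalSets n, ∃ a : DDP n, shiftDown (SymInv.domain a.1) = s := fun s hs =>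
    ⟨DDP.partialId n s, by
      rw [DDP.domain_partialId (mem_normalSets.1 hs).1, shiftDown_of_mem_normalSets hs]⟩
  unfold numDStarClasses
  exact two_mul_card_quotient_of_involution (greenDStar (DDP n)) (normalSets n)
    (fun a => shiftDown (SymInv.domain a.1)) DDP.shiftDown_domain_mem hsurj (reflectShort n)
    (fun _ => reflectShort_mem_normalSets) (fun _ => reflectShort_reflectShort) DDP.greenDStar_iff

/-! ### Counting normal sets and fixed points -/

section Counting

open Finset

/-- The subsets of `{0, …, k}` containing `0` and `k`. -/
def spanSets (k : ℕ) : Finset (Finset ℕ) := {s ∈ (range (k + 1)).powerset | 0 ∈ s ∧ k ∈ s}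

theorem mem_spanSets {k : ℕ} {s : Finset ℕ} :
    s ∈ spanSets k ↔ (∀ x ∈ s, x ≤ k) ∧ 0 ∈ s ∧ k ∈ s := by
  simp only [spanSets, mem_filter, mem_powerset, subset_iff, mem_range, Nat.lt_succ_iff]

theorem card_spanSets_succ (k : ℕ) : #(spanSets (k + 1)) = 2 ^ k := by
  have : #(Finset.Ioo 0 (k + 1)) = k := by simp
  rw [← congrArg (2 ^ ·) this, ← card_powerset]
  refine card_nbij' (fun s => s ∩ Finset.Ioo 0 (k + 1)) (fun t => t ∪ {0, k + 1}) ?_ ?_ ?_ ?_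
  · intro s _
    simp
  · intro t ht
    simp only [coe_powerset, Set.mem_preimage, Set.mem_powerset_iff, coe_subset] at ht
    simp only [mem_coe, mem_spanSets, mem_union, mem_insert, mem_singleton]
    refine ⟨fun x hx => ?_, by simp, by simp⟩
    rcases hx with hx | hx
    · have := mem_Ioo.1 (ht hx)
      omega
    · omega
  · intro s hs
    obtain ⟨h1, h2, h3⟩ := mem_spanSets.1 hs
    ext x
    simp only [mem_union, mem_inter, mem_Ioo, mem_insert, mem_singleton]
    constructor
    · rintro (h | rfl | rfl) <;> tauto
    · intro h
      have := h1 x h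
      by_cases hx : x = 0 ∨ x = k + 1
      · exact Or.inr hx
      · exact Or.inl ⟨h, by omega⟩
  · intro t ht
    simp only [coe_powerset, Set.mem_preimage, Set.mem_powerset_iff, coe_subset] at ht
    ext x
    simp only [mem_union, mem_inter, mem_Ioo, mem_insert, mem_singleton]
    constructor
    · rintro ⟨h | h, h'⟩
      · exact h
      · omega
    · intro h
      exact ⟨Or.inl h, mem_Ioo.1 (ht h)⟩

/-- A palindrome containing the endpoints is determined by its free part in `{1, …, k / 2}`, which
includes the midpoint when `k` is even and positive. -/
theorem card_palindromic_spanSets (k : ℕ) :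
    #{s ∈ spanSets k | s.image (k - ·) = s} = 2 ^ (k / 2) := by
  have : #(Finset.Icc 1 (k / 2)) = k / 2 := by simp
  rw [← congrArg (2 ^ ·) this, ← card_powerset]
  refine card_nbij' (fun s => s ∩ Finset.Icc 1 (k / 2))
    (fun t => t ∪ t.image (k - ·) ∪ {0, k}) ?_ ?_ ?_ ?_
  · intro s _
    simp
  · intro t ht
    simp only [coe_powerset, Set.mem_preimage, Set.mem_powerset_iff, coe_subset] at ht
    have ht' : ∀ x ∈ t, 1 ≤ x ∧ x ≤ k / 2 := fun x hx => mem_Icc.1 (ht hx)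
    simp only [mem_coe, mem_filter, mem_spanSets, mem_union, mem_insert, mem_singleton]
    refine ⟨⟨?_, by simp, by simp⟩, ?_⟩
    · rintro x ((hx | hx) | hx)
      · have := ht' x hx
        omega
      · obtain ⟨y, hy, rfl⟩ := mem_image.1 hx
        omega
      · omega
    · rw [image_union, image_union, image_image, image_insert, image_singleton, Nat.sub_zero,
        Nat.sub_self, pair_comm k 0, union_comm (t.image _) _]
      congr 2
      conv_rhs => rw [← image_id (s := t)]
      refine image_congr fun x hx => ?_
      have := ht' x hx
      simp only [Function.comp, id]
      omega
  · intro s hs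
    simp only [mem_coe, mem_filter, mem_spanSets] at hs
    obtain ⟨⟨h1, h2, h3⟩, h4⟩ := hs
    have h5 : ∀ x ∈ s, k - x ∈ s := fun x hx => h4 ▸ mem_image_of_mem _ hx
    ext x
    simp only [mem_union, mem_inter, mem_Icc, mem_insert, mem_singleton, mem_image]
    constructor
    · rintro ((h | ⟨y, ⟨hy, -⟩, rfl⟩) | rfl | rfl)
      · exact h.1
      · exact h5 y hy
      · exact h2
      · exact h3
    · intro h
      have := h1 x h
      by_cases hx : x = 0 ∨ x = k
      · exact Or.inr hx
      · by_cases hx' : x ≤ k / 2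
        · exact Or.inl (Or.inl ⟨h, by omega⟩)
        · exact Or.inl (Or.inr ⟨k - x, ⟨h5 x h, by omega⟩, by omega⟩)
  · intro t ht
    simp only [coe_powerset, Set.mem_preimage, Set.mem_powerset_iff, coe_subset] at ht
    have ht' : ∀ x ∈ t, 1 ≤ x ∧ x ≤ k / 2 := fun x hx => mem_Icc.1 (ht hx)
    ext x
    simp only [mem_union, mem_inter, mem_Icc, mem_insert, mem_singleton, mem_image]
    constructor
    · rintro ⟨(h | ⟨y, hy, rfl⟩) | h, h'⟩
      · exact h
      · have := ht' y hy
        -- Both `y` and `k - y` are at most `k / 2`, so `y` is the midpoint.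
        rwa [show k - y = y by omega]
      · omega
    · intro h
      exact ⟨Or.inl (Or.inl h), ht' x h⟩

theorem normalSets_eq (n : ℕ) : normalSets n = insert ∅ ((range n).biUnion spanSets) := by
  ext s
  simp only [mem_normalSets, mem_insert, mem_biUnion, mem_range, mem_spanSets]
  constructor
  · rintro ⟨h, rfl | h0⟩
    · exact Or.inl rfl
    · obtain ⟨k, hk, hk'⟩ := exists_isGreatest_nat ⟨0, h0⟩
      exact Or.inr ⟨k, mem_range.1 (h hk), hk', h0, hk⟩
  · rintro (rfl | ⟨k, hk, h1, h2, h3⟩)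
    · simp
    · exact ⟨fun x hx => mem_range.2 ((h1 x hx).trans_lt hk), Or.inr h2⟩

theorem card_filter_normalSets (n : ℕ) (p : Finset ℕ → Prop) [DecidablePred p] (h : p ∅) :
    #{s ∈ normalSets n | p s} = 1 + ∑ k ∈ range n, #{s ∈ spanSets k | p s} := by
  rw [normalSets_eq, filter_insert, if_pos h, card_insert_of_notMem, filter_biUnion, card_biUnion,
    add_comm]
  · intro i _ j _ hij
    simp only [Function.onFun, disjoint_left]
    intro s hs hs'
    simp only [mem_filter, mem_spanSets] at hs hs'
    exact hij (le_antisymm (hs'.1.1 i hs.1.2.2) (hs.1.1 j hs'.1.2.2))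
  · simp [mem_spanSets]

theorem card_normalSets_succ (n : ℕ) : #(normalSets (n + 1)) = 2 ^ n + 1 := by
  have h := card_filter_normalSets (n + 1) (fun _ => True) trivial
  simp only [filter_true] at h
  rw [h, sum_range_succ', sum_congr rfl fun k _ => card_spanSets_succ k]
  have h0 : #(spanSets 0) = 1 := rfl
  rw [h0, Nat.geomSum_eq le_rfl n]
  have := Nat.one_le_two_pow (n := n)
  simp
  omega

theorem card_filter_reflectShort_spanSets (n k : ℕ) :
    #{s ∈ spanSets k | reflectShort n s = s} = if 2 * k < n then 2 ^ (k / 2) else #(spanSets k) := by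
  split_ifs with h
  · rw [← card_palindromic_spanSets]
    congr 1
    refine filter_congr fun s hs => ?_
    obtain ⟨h1, h2, h3⟩ := mem_spanSets.1 hs
    rw [reflectShort_eq h3 h1 h]
  · congr 1
    refine filter_true_of_mem fun s hs => ?_
    exact reflectShort_eq_self (mem_spanSets.1 hs).2.2 (not_lt.1 h)

/-- With `n = m + 1`, the short lengths are `k ≤ m / 2`. The longer ones contribute the sum of `2 ^
(k - 1)`, namely `2 ^ m - 2 ^ (m / 2)`; the subtracted term is moved to the left to stay in `ℕ`. -/
theorem two_mul_numDStarClasses_succ (m : ℕ) :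
    2 * numDStarClasses (m + 1) + 2 ^ (m / 2) =
      2 ^ (m + 1) + 2 + ∑ k ∈ range (m / 2 + 1), 2 ^ (k / 2) := by
  obtain ⟨r, hr⟩ := Nat.exists_eq_add_of_le (Nat.div_le_self m 2)
  have hsum : ∑ k ∈ range (m + 1), #{s ∈ spanSets k | reflectShort (m + 1) s = s} + 2 ^ (m / 2) =
      ∑ k ∈ range (m / 2 + 1), 2 ^ (k / 2) + 2 ^ m := by
    have h1 : m + 1 = m / 2 + 1 + r := by omega
    rw [show range (m + 1) = range (m / 2 + 1 + r) by rw [← h1], sum_range_add, add_assoc]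
    congr 1
    · refine sum_congr rfl fun k hk => ?_
      have := mem_range.1 hk
      rw [card_filter_reflectShort_spanSets, if_pos (by omega)]
    · have h2 : ∀ i ∈ range r, #{s ∈ spanSets (m / 2 + 1 + i) | reflectShort (m + 1) s = s} =
          2 ^ (m / 2) * 2 ^ i := by
        intro i _
        rw [card_filter_reflectShort_spanSets, if_neg (by omega),
          show m / 2 + 1 + i = m / 2 + i + 1 by ring, card_spanSets_succ, pow_add]
      rw [sum_congr rfl h2, ← mul_sum, Nat.geomSum_eq le_rfl]
      conv_rhs => rw [hr, pow_add]
      rw [← Nat.mul_succ]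
      congr 1
      have := Nat.one_le_two_pow (n := r)
      simp
      omega
  have h := two_mul_numDStarClasses (m + 1)
  rw [card_normalSets_succ, card_filter_normalSets _ (fun s => reflectShort (m + 1) s = s) (reflectShort_empty _)] at h
  rw [pow_succ]
  omega

theorem sum_two_pow_half_even (j : ℕ) :
    ∑ k ∈ range (2 * j), 2 ^ (k / 2) + 2 = 2 * 2 ^ j := by
  induction j with
  | zero => rfl
  | succ j ih =>
    rw [show 2 * (j + 1) = 2 * j + 1 + 1 by ring, sum_range_succ, sum_range_succ,
      show 2 * j / 2 = j by omega, show (2 * j + 1) / 2 = j by omega, pow_succ]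
    omega

theorem sum_two_pow_half_odd (j : ℕ) :
    ∑ k ∈ range (2 * j + 1), 2 ^ (k / 2) + 2 = 3 * 2 ^ j := by
  have := sum_two_pow_half_even j
  rw [sum_range_succ, show 2 * j / 2 = j by omega]
  omega

/-- The number of short lengths, `m / 2 + 1`, is even exactly when `m + 1` is 3 or 0 modulo 4,
whence the two cases of the formula. -/
theorem two_mul_numDStarClasses_of_even {m j : ℕ} (h : m / 2 + 1 = 2 * j) :
    2 * (numDStarClasses (m + 1) : ℚ) = 2 ^ (m + 1) - 2 ^ (m / 2) + 2 * 2 ^ j := by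
  have h1 := two_mul_numDStarClasses_succ m
  have h2 := sum_two_pow_half_even j
  rw [h] at h1
  rw [add_assoc, add_comm 2, h2] at h1
  have : (2 * numDStarClasses (m + 1) + 2 ^ (m / 2) : ℚ) = 2 ^ (m + 1) + 2 * 2 ^ j := by
    exact_mod_cast h1
  linarith

theorem two_mul_numDStarClasses_of_odd {m j : ℕ} (h : m / 2 = 2 * j) :
    2 * (numDStarClasses (m + 1) : ℚ) = 2 ^ (m + 1) - 2 ^ (m / 2) + 3 * 2 ^ j := by
  have h1 := two_mul_numDStarClasses_succ m
  have h2 := sum_two_pow_half_odd j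
  rw [add_assoc, add_comm 2, show m / 2 + 1 = 2 * j + 1 by omega, h2] at h1
  have : (2 * numDStarClasses (m + 1) + 2 ^ (m / 2) : ℚ) = 2 ^ (m + 1) + 3 * 2 ^ j := by
    exact_mod_cast h1
  linarith

/-- Raising the exponent by one makes it natural even when `z = -1`, as happens for `n = 1, 2`. -/
theorem two_zpow_eq_half {z : ℤ} {k : ℕ} (h : z + 1 = k) : (2 : ℚ) ^ z = 2 ^ k / 2 := by
  rw [show z = (k : ℤ) - 1 by omega, zpow_sub₀ two_ne_zero, zpow_natCast, zpow_one]

end Counting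

/-- All exponents are integers (division in `ℤ` by a positive integer is the floor of the
quotient), since `⌊(n-3)/2⌋` and `⌊(n-3)/4⌋` are negative for `n = 1, 2`. -/
theorem corollary3p9 (n : ℕ) (hn : 1 ≤ n) :
    ((n % 4 = 3 ∨ n % 4 = 0) →
      (numDStarClasses n : ℚ) =
        2 ^ ((n : ℤ) - 1) - 2 ^ (((n : ℤ) - 3) / 2) + 2 ^ (((n : ℤ) + 1) / 4)) ∧
    ((n % 4 = 1 ∨ n % 4 = 2) →
      (numDStarClasses n : ℚ) =
        2 ^ ((n : ℤ) - 1) - 2 ^ (((n : ℤ) - 3) / 2) + 3 * 2 ^ (((n : ℤ) - 3) / 4)) := by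
  obtain ⟨m, rfl⟩ := Nat.exists_eq_add_of_le' hn
  rw [two_zpow_eq_half (z := ((m + 1 : ℕ) : ℤ) - 1) (k := m + 1) (by omega),
    two_zpow_eq_half (z := (((m + 1 : ℕ) : ℤ) - 3) / 2) (k := m / 2) (by omega)]
  constructor
  · intro h
    have := two_mul_numDStarClasses_of_even (m := m) (j := (m + 2) / 4) (by omega)
    rw [show (((m + 1 : ℕ) : ℤ) + 1) / 4 = ((m + 2) / 4 : ℕ) by omega, zpow_natCast]
    linarith
  · intro h
    have := two_mul_numDStarClasses_of_odd (m := m) (j := m / 4) (by omega)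
    rw [two_zpow_eq_half (z := (((m + 1 : ℕ) : ℤ) - 3) / 4) (k := m / 4) (by omega)]
    linarith
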